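/- Let $\mathcal M$ be a compact (Hausdorff) topological manifold without boundary, of dimension $d$, let $R:\mathcal M\to\mathcal M$ be a homeomorphism, let $\mu$ be an $R$-invariant Borel probability measure on $\mathcal M$ which is aperiodic (that is, the set of periodic points of $R$ has $\mu$-measure $0$), and let $A\subset\mathcal M$ be a Borel set with $\mu(A)>0$. Then for every $\varepsilon>0$ there exists a Cantor set $K\subset A$ (a non-empty metrisable totally disconnected compact set without isolated points) such that: 1. $K$ is dynamically coherent for $R$: for each $k\in\mathbb Z$ the set $R^k(K)\cap K$ is open in $K$; and for every integer $p\ge 0$ and every $x\in K$ there are integers $k,\ell\ge 1$ such that none of the points $R^{k}(x),\dots,R^{k+p}(x)$ and $R^{-\ell}(x),\dots,R^{-\ell-p}(x)$ lies in $K$; 2. $K\cap R(K)=\emptyset$; 3. $K$ is tamely embedded: every open set containing $K$ contains a neighbourhood of $K$ which is a finite union of pairwise disjoint subsets of $\mathcal M$, each homeomorphic to the closed unit ball of $\mathbb R^d$; 4. $K$ is dynamically meagre for $R$: $K$ has empty interior in $\Lambda=\mathrm{Cl}\left(\bigcup_{i\in\mathbb Z}R^i(K)\right)$; 5. $\left|\mu\left(\bigcup_{k\in\mathbb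 Z}R^k(A)\right)-\mu\left(\bigcup_{k\in\mathbb Z}R^k(K)\right)\right|<\varepsilon$, and $\mu(K)>0$. -/

import Mathlib

/-- `K` is a Cantor set: nonempty, metrisable, compact, totally disconnected, and without
isolated points (every point of `K` is an accumulation point of `K`). -/
structure IsCantorSet {M : Type*} [TopologicalSpace M] (K : Set M) : Prop where
  nonempty : K.Nonempty
  metrizable : TopologicalSpace.MetrizableSpace K
  isCompact : IsCompact K
  isTotallyDisconnected : IsTotallyDisconnected K
  preperfect : Preperfect K

/-- A rectangle of a `d`-dimensional manifold: a subset homeomorphic to the closed unit ball of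
`ℝᵈ`. -/
def IsRectangle (d : ℕ) {M : Type*} [TopologicalSpace M] (X : Set M) : Prop :=
  Nonempty (X ≃ₜ Metric.closedBall (0 : EuclideanSpace ℝ (Fin d)) 1)

/-- `K` is tamely embedded: it has arbitrarily small neighbourhoods that are finite unions of
pairwise disjoint rectangles. -/
def IsTamelyEmbedded (d : ℕ) {M : Type*} [TopologicalSpace M] (K : Set M) : Prop :=
  ∀ U : Set M, IsOpen U → K ⊆ U →
    ∃ E : Set (Set M), E.Finite ∧ (∀ X ∈ E, IsRectangle d X) ∧ E.PairwiseDisjoint id ∧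
      K ⊆ interior (⋃₀ E) ∧ ⋃₀ E ⊆ U

/-- `K` is dynamically coherent for `R`: each `R^k(K) ∩ K` is open in `K`, and every point of `K`
has arbitrarily long runs of consecutive positive iterates, and of consecutive negative iterates,
outside `K`. -/
structure IsDynamicallyCoherent {M : Type*} [TopologicalSpace M] (R : M ≃ₜ M) (K : Set M) :
    Prop where
  isOpen_inter : ∀ k : ℤ, IsOpen ((↑) ⁻¹' ((R ^ k) '' K ∩ K) : Set K)
  exists_forward : ∀ p : ℕ, ∀ x ∈ K, ∃ k : ℕ, 1 ≤ k ∧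
    ∀ j : ℕ, j ≤ p → (R ^ ((k : ℤ) + j)) x ∉ K
  exists_backward : ∀ p : ℕ, ∀ x ∈ K, ∃ l : ℕ, 1 ≤ l ∧
    ∀ j : ℕ, j ≤ p → (R ^ (-(l : ℤ) - j)) x ∉ K

/-- The saturation `⋃ₖ R^k(K)`, `k ∈ ℤ`. -/
def orbitSaturation {M : Type*} [TopologicalSpace M] (R : M ≃ₜ M) (K : Set M) : Set M :=
  ⋃ k : ℤ, (R ^ k) '' K

/-- `K` is dynamically meagre for `R`: it has empty interior in the closure `Λ` of `⋃ₖ R^k(K)`,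
for the subspace topology of `Λ`. -/
def IsDynamicallyMeagre {M : Type*} [TopologicalSpace M] (R : M ≃ₜ M) (K : Set M) : Prop :=
  interior ((↑) ⁻¹' K : Set (closure (orbitSaturation R K))) = ∅

/-!
Let `C ⊆ A` meet almost every orbit that meets `A`, with `C ∩ R(C) = ∅`. Aperiodicity makes it
possible to choose a set `Z` of small measure such that almost every orbit has arbitrarily long runs
in `Z` and accumulates at each of its points along visits to `Z`, and such that finitely many
disjoint rectangles of any prescribed size cover a neighbourhood of the complement of `Z`. A closed
set `K ⊆ C \ Z` that almost exhausts `C` then has all the required properties, provided that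
`R^k(K) ∩ K` is open in `K` for every `k` and that `μ` restricted to `K` has support `K`.

To obtain such a `K`, small sets `D` have to be removed from `C \ Z` off which the return sets are
relatively clopen (Lusin), but removing `D` alters these return sets. The runs of length `m` in `Z`
cut every orbit into finite blocks, and two points of `C \ Z` at most `m` steps apart on the same
orbit lie in the same block. Hence removing the entire blocks that meet `D` preserves the returns at
times up to `m` of the points that are kept, and if `D` is small enough, then so is the union of
these blocks. The set `K` is the support of `μ` restricted to the limit of this procedure as `m`
tends to infinity.
-/

open MeasureTheory Set Filter Topology Metric
open scoped ENNReal

section Measure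

variable {α : Type*} [MeasurableSpace α] {μ : Measure α}

theorem measure_sdiff_iInter_le_tsum (μ : Measure α) (T : ℕ → Set α) :
    μ (T 0 \ ⋂ m, T m) ≤ ∑' m, μ (T m \ T (m + 1)) := by
  refine (measure_mono fun x hx => ?_).trans (measure_iUnion_le fun m => T m \ T (m + 1))
  by_contra hstay
  simp only [mem_iUnion, Set.mem_sdiff, not_exists, not_and_not_right] at hstay
  exact hx.2 (mem_iInter.2 fun m => Nat.rec hx.1 hstay m)

theorem abs_measureReal_sub_lt_of_subset [IsFiniteMeasure μ] {s t : Set α} (hst : s ⊆ t)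
    (hs : MeasurableSet s) {ε : ℝ} (h : μ (t \ s) < ENNReal.ofReal ε) :
    |μ.real t - μ.real s| < ε := by
  rw [← measureReal_sdiff hst hs, abs_of_nonneg measureReal_nonneg, measureReal_def]
  exact (ENNReal.lt_ofReal_iff_toReal_lt (measure_ne_top _ _)).1 h

theorem exists_finset_measure_sdiff_biUnion_lt {ι : Type*} [Countable ι] {V : Set α} {X : ι → Set α}
    (hV : NullMeasurableSet V μ) (hVtop : μ V ≠ ∞) (hX : ∀ i, NullMeasurableSet (X i) μ)
    (hcover : μ (V \ ⋃ i, X i) = 0) {δ : ℝ≥0∞} (hδ : δ ≠ 0) :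
    ∃ u : Finset ι, μ (V \ ⋃ i ∈ u, X i) < δ := by
  let W : Finset ι → Set α := fun u => V \ ⋃ i ∈ u, X i
  have hW : Antitone W := fun u v huv => sdiff_subset_sdiff_right (biUnion_subset_biUnion_left huv)
  have hWm : ∀ u, NullMeasurableSet (W u) μ := fun u =>
    hV.diff (.biUnion (Finset.countable_toSet u) fun i _ => hX i)
  have hlim := tendsto_measure_iInter_atTop hWm hW ⟨∅, by simpa [W] using hVtop⟩
  have hinter : ⋂ u, W u = V \ ⋃ i, X i := by
    rw [iUnion_eq_iUnion_finset, sdiff_iUnion]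
  rw [hinter, hcover] at hlim
  exact (hlim.eventually_lt_const (pos_iff_ne_zero.2 hδ)).exists

variable [TopologicalSpace α] [OpensMeasurableSpace α] [IsFiniteMeasure μ] [μ.WeaklyRegular]

theorem exists_isOpen_measure_lt_isClosed_sdiff {Q : Set α} (hQ : MeasurableSet Q) {δ : ℝ≥0∞}
    (hδ : δ ≠ 0) : ∃ D, IsOpen D ∧ μ D < δ ∧ IsClosed (Q \ D) ∧ IsClosed (Qᶜ \ D) := by
  have hδ2 : δ / 2 ≠ 0 := (ENNReal.half_pos hδ).ne'
  obtain ⟨F, hFQ, hF, hFμ⟩ := hQ.exists_isClosed_sdiff_lt (measure_ne_top μ _) hδ2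
  obtain ⟨G, hGQ, hG, hGμ⟩ := hQ.compl.exists_isClosed_sdiff_lt (measure_ne_top μ _) hδ2
  have hQF : Q \ (F ∪ G)ᶜ = F := by grind
  have hQG : Qᶜ \ (F ∪ G)ᶜ = G := by grind
  refine ⟨(F ∪ G)ᶜ, (hF.union hG).isOpen_compl, ?_, by rwa [hQF], by rwa [hQG]⟩
  calc μ (F ∪ G)ᶜ ≤ μ (Q \ F ∪ Qᶜ \ G) := measure_mono fun x hx => by grind
    _ ≤ μ (Q \ F) + μ (Qᶜ \ G) := measure_union_le _ _
    _ < δ / 2 + δ / 2 := ENNReal.add_lt_add hFμ hGμ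
    _ = δ := ENNReal.add_halves δ

/- The indicator functions of the `Q i` are continuous on the complement of `D`: this is Lusin's
theorem for countably many sets. -/
theorem exists_isOpen_measure_lt_forall_isClosed_sdiff {ι : Type*} [Countable ι] {Q : ι → Set α}
    (hQ : ∀ i, MeasurableSet (Q i)) {δ : ℝ≥0∞} (hδ : δ ≠ 0) :
    ∃ D, IsOpen D ∧ μ D < δ ∧ ∀ i, IsClosed (Q i \ D) ∧ IsClosed ((Q i)ᶜ \ D) := by
  obtain ⟨δ', hδ_pos, hδ'⟩ := ENNReal.exists_pos_sum_of_countable' hδ ι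
  choose D hD hDμ hQD hQcD using fun i =>
    exists_isOpen_measure_lt_isClosed_sdiff (μ := μ) (hQ i) (hδ_pos i).ne'
  have hsdiff : ∀ (i : ι) (s : Set α), s \ ⋃ j, D j = (s \ D i) \ ⋃ j, D j := fun i s => by
    rw [sdiff_sdiff, union_eq_self_of_subset_left (subset_iUnion D i)]
  refine ⟨⋃ i, D i, isOpen_iUnion hD, (measure_iUnion_le D).trans_lt
    ((ENNReal.tsum_le_tsum fun i => (hDμ i).le).trans_lt hδ'), fun i => ⟨?_, ?_⟩⟩
  · rw [hsdiff i]
    exact (hQD i).sdiff (isOpen_iUnion hD)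
  · rw [hsdiff i]
    exact (hQcD i).sdiff (isOpen_iUnion hD)

end Measure

section Orbits

variable {M : Type*} [TopologicalSpace M] {R : M ≃ₜ M} {C S : Set M} {N : ℕ}

theorem zpow_add_apply (R : M ≃ₜ M) (a b : ℤ) (x : M) :
    (R ^ (a + b)) x = (R ^ a) ((R ^ b) x) := by
  rw [zpow_add, Homeomorph.mul_apply]

theorem zpow_natCast_apply (R : M ≃ₜ M) (n : ℕ) (x : M) : (R ^ (n : ℤ)) x = R^[n] x := by
  induction n generalizing x with
  | zero => simp
  | succ n ih => rw [Nat.cast_succ, zpow_add_apply, zpow_one, ih, Function.iterate_succ_apply]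

theorem image_zpow_eq_preimage (R : M ≃ₜ M) (k : ℤ) (S : Set M) :
    (R ^ k) '' S = (R ^ (-k)) ⁻¹' S := by
  rw [zpow_neg]
  exact (R ^ k).image_eq_preimage_symm S

theorem orbitSaturation_eq_iUnion_preimage (R : M ≃ₜ M) (S : Set M) :
    orbitSaturation R S = ⋃ k : ℤ, (R ^ k) ⁻¹' S := by
  simp only [orbitSaturation, image_zpow_eq_preimage]
  exact (Equiv.neg ℤ).surjective.iUnion_comp fun k => (R ^ k) ⁻¹' S

theorem mem_orbitSaturation_iff {x : M} : x ∈ orbitSaturation R S ↔ ∃ k : ℤ, (R ^ k) x ∈ S := by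
  simp only [orbitSaturation_eq_iUnion_preimage, mem_iUnion, mem_preimage]

theorem zpow_mem_orbitSaturation_iff {x : M} (k : ℤ) :
    (R ^ k) x ∈ orbitSaturation R S ↔ x ∈ orbitSaturation R S := by
  simp only [mem_orbitSaturation_iff, ← zpow_add_apply]
  exact (Equiv.addRight k).surjective.exists (p := fun j => (R ^ j) x ∈ S) |>.symm

theorem subset_orbitSaturation : S ⊆ orbitSaturation R S := fun x hx =>
  mem_orbitSaturation_iff.2 ⟨0, by simpa using hx⟩

theorem orbitSaturation_mono {T : Set M} (h : S ⊆ T) :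
    orbitSaturation R S ⊆ orbitSaturation R T :=
  iUnion_mono fun _ => image_mono h

theorem orbitSaturation_sdiff_subset (R : M ≃ₜ M) (S C : Set M) :
    orbitSaturation R S \ orbitSaturation R C ⊆ orbitSaturation R (S \ orbitSaturation R C) := by
  rintro x ⟨hxS, hxC⟩
  obtain ⟨k, hk⟩ := mem_orbitSaturation_iff.1 hxS
  exact mem_orbitSaturation_iff.2 ⟨k, hk, fun h => hxC ((zpow_mem_orbitSaturation_iff k).1 h)⟩

theorem orbitSaturation_inv (R : M ≃ₜ M) (S : Set M) :
    orbitSaturation R⁻¹ S = orbitSaturation R S := by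
  simp only [orbitSaturation, inv_zpow']
  exact (Equiv.neg ℤ).surjective.iUnion_comp fun k => (R ^ k) '' S

/-- Every return of a point of `C` to `C` takes more than `N` steps; equivalently, the sets
`C, R(C), …, R^N(C)` are pairwise disjoint. -/
def ReturnTimesExceed (R : M ≃ₜ M) (N : ℕ) (C : Set M) : Prop :=
  ∀ j ∈ Finset.Icc 1 N, ∀ x ∈ C, (R ^ (j : ℤ)) x ∉ C

theorem ReturnTimesExceed.mono {C' : Set M} (h : ReturnTimesExceed R N C) (hC : C' ⊆ C) :
    ReturnTimesExceed R N C' :=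
  fun j hj x hx hx' => h j hj x (hC hx) (hC hx')

theorem ReturnTimesExceed.disjoint_image (h : ReturnTimesExceed R 1 C) : Disjoint C (R '' C) := by
  rw [disjoint_right]
  rintro _ ⟨x, hx, rfl⟩
  simpa using h 1 (by simp) x hx

theorem ReturnTimesExceed.pairwiseDisjoint (h : ReturnTimesExceed R N C) :
    (Finset.range (N + 1) : Set ℕ).PairwiseDisjoint fun j => (R ^ (j : ℤ)) ⁻¹' C := by
  have hlt : ∀ i j : ℕ, i < j → j ≤ N → Disjoint ((R ^ (i : ℤ)) ⁻¹' C) ((R ^ (j : ℤ)) ⁻¹' C) := by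
    refine fun i j hij hj => disjoint_left.2 fun x hx hx' => ?_
    refine h (j - i) (Finset.mem_Icc.2 ⟨by omega, by omega⟩) _ hx ?_
    rwa [← zpow_add_apply, Nat.cast_sub hij.le, sub_add_cancel]
  intro i hi j hj hne
  simp only [Finset.coe_range, mem_Iio, Nat.lt_succ_iff] at hi hj
  rcases hne.lt_or_gt with hij | hij
  · exact hlt i j hij hj
  · exact (hlt j i hij hi).symm

theorem eventually_smallSets_returnTimesExceed [T2Space M] (R : M ≃ₜ M) (N : ℕ) {x : M}
    (hx : x ∉ Function.periodicPts R) : ∀ᶠ U in (𝓝 x).smallSets, ReturnTimesExceed R N U := by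
  refine (Finset.eventually_all _).2 fun j hj => ?_
  have hne : x ≠ (R ^ (j : ℤ)) x := fun h => hx <| Function.mk_mem_periodicPts
    (Finset.mem_Icc.1 hj).1 ((zpow_natCast_apply R j x).symm.trans h.symm)
  obtain ⟨V, W, hV, hW, hxV, hxW, hVW⟩ := t2_separation hne
  have hnhds : V ∩ (R ^ (j : ℤ)) ⁻¹' W ∈ 𝓝 x :=
    (hV.inter (hW.preimage (R ^ (j : ℤ)).continuous)).mem_nhds ⟨hxV, hxW⟩
  exact eventually_smallSets.2 ⟨_, hnhds, fun U hU y hy hy' =>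
    disjoint_left.1 hVW (hU hy').1 (hU hy).2⟩

theorem measurable_zpow [MeasurableSpace M] [BorelSpace M] (R : M ≃ₜ M) (k : ℤ) :
    Measurable (R ^ k) :=
  (R ^ k).continuous.measurable

theorem measurableSet_orbitSaturation [MeasurableSpace M] [BorelSpace M] (hS : MeasurableSet S) :
    MeasurableSet (orbitSaturation R S) := by
  rw [orbitSaturation_eq_iUnion_preimage]
  exact .iUnion fun k => measurable_zpow R k hS

theorem exists_returnTimesExceed_subset_iUnion [MeasurableSpace M] [BorelSpace M]
    {ι : Type*} [Countable ι] {S : ι → Set M} (hS : ∀ i, MeasurableSet (S i))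
    (hret : ∀ i, ReturnTimesExceed R N (S i)) :
    ∃ C ⊆ ⋃ i, S i, MeasurableSet C ∧ ReturnTimesExceed R N C ∧
      ⋃ i, S i ⊆ orbitSaturation R C := by
  obtain ⟨f, hf⟩ := exists_injective_nat ι
  let D : ι → Set M := fun i => S i \ ⋃ j, ⋃ (_ : f j < f i), orbitSaturation R (S j)
  have mem_D : ∀ i x, x ∈ D i ↔ x ∈ S i ∧ ∀ j, f j < f i → x ∉ orbitSaturation R (S j) := by
    simp [D]
  refine ⟨⋃ i, D i, iUnion_mono fun i => sdiff_subset, ?_, fun m hm x hx hmx => ?_, ?_⟩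
  · exact .iUnion fun i => (hS i).diff <|
      .iUnion fun j => .iUnion fun _ => measurableSet_orbitSaturation (hS j)
  · obtain ⟨i, hi⟩ := mem_iUnion.1 hx
    obtain ⟨j, hj⟩ := mem_iUnion.1 hmx
    rw [mem_D] at hi hj
    rcases lt_trichotomy (f i) (f j) with hij | hij | hij
    · exact hj.2 i hij ((zpow_mem_orbitSaturation_iff m).2 (subset_orbitSaturation hi.1))
    · obtain rfl := hf hij
      exact hret i m hm x hi.1 hj.1
    · exact hi.2 j hij ((zpow_mem_orbitSaturation_iff m).1 (subset_orbitSaturation hj.1))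
  · refine iUnion_subset fun i x hx => ?_
    obtain ⟨j, hxj, hmin⟩ := (InvImage.wf f wellFounded_lt).has_min
      {j | x ∈ orbitSaturation R (S j)} ⟨i, subset_orbitSaturation hx⟩
    obtain ⟨k, hk⟩ := mem_orbitSaturation_iff.1 hxj
    refine mem_orbitSaturation_iff.2 ⟨k, mem_iUnion.2 ⟨j, (mem_D _ _).2 ⟨hk, fun l hl hkl => ?_⟩⟩⟩
    exact hmin l ((zpow_mem_orbitSaturation_iff k).1 hkl) hl

theorem exists_sweeping_subset [T2Space M] [SecondCountableTopology M] [MeasurableSpace M]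
    [BorelSpace M] (R : M ≃ₜ M) {A : Set M} (hA : MeasurableSet A) (N : ℕ) :
    ∃ C ⊆ A, MeasurableSet C ∧ ReturnTimesExceed R N C ∧
      A \ Function.periodicPts R ⊆ orbitSaturation R C := by
  have hnhds : ∀ x ∈ A \ Function.periodicPts R,
      ∃ U, IsOpen U ∧ x ∈ U ∧ ReturnTimesExceed R N U := by
    intro x hx
    obtain ⟨V, hV, hVret⟩ :=
      eventually_smallSets.1 (eventually_smallSets_returnTimesExceed R N hx.2)
    obtain ⟨U, hUV, hU, hxU⟩ := mem_nhds_iff.1 hV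
    exact ⟨U, hU, hxU, hVret U hUV⟩
  choose! U hU hxU hUret using hnhds
  obtain ⟨t, htA, ht, hcover⟩ := TopologicalSpace.countable_cover_nhdsWithin fun x hx =>
    mem_nhdsWithin_of_mem_nhds ((hU x hx).mem_nhds (hxU x hx))
  have := ht.to_subtype
  obtain ⟨C, hCA, hC, hret, hsat⟩ := exists_returnTimesExceed_subset_iUnion
    (S := fun x : t => A ∩ U x) (fun x => hA.inter (hU x (htA x.2)).measurableSet)
    fun x => (hUret x (htA x.2)).mono inter_subset_right
  refine ⟨C, hCA.trans (iUnion_subset fun x => inter_subset_left), hC, hret, fun x hx => hsat ?_⟩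
  obtain ⟨y, hy, hxy⟩ := mem_iUnion₂.1 (hcover hx)
  exact mem_iUnion.2 ⟨⟨y, hy⟩, hx.1, hxy⟩

/-- The orbit of `x` visits `C` at arbitrarily large positive and arbitrarily large negative
times. -/
def VisitsInfinitelyOften (R : M ≃ₜ M) (C : Set M) (x : M) : Prop :=
  (∃ᶠ k : ℤ in atTop, (R ^ k) x ∈ C) ∧ ∃ᶠ k : ℤ in atBot, (R ^ k) x ∈ C

theorem VisitsInfinitelyOften.mono {C' : Set M} {x : M} (h : VisitsInfinitelyOften R C x)
    (hC : C ⊆ C') : VisitsInfinitelyOften R C' x :=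
  ⟨h.1.mono fun _ hk => hC hk, h.2.mono fun _ hk => hC hk⟩

end Orbits

section InvariantMeasure

variable {M : Type*} [TopologicalSpace M] [MeasurableSpace M] [BorelSpace M] {R : M ≃ₜ M}
  {μ : Measure M} {A C : Set M}

theorem measurePreserving_zpow (hinv : MeasurePreserving R μ μ) (k : ℤ) :
    MeasurePreserving (R ^ k) μ μ :=
  zpow_induction_right (P := fun S : M ≃ₜ M => MeasurePreserving S μ μ) (.id μ)
    (fun _ hS => hS.comp hinv)
    (fun _ hS => hS.comp (MeasurePreserving.symm R.toMeasurableEquiv hinv)) k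

theorem measure_zpow_preimage (hinv : MeasurePreserving R μ μ) (k : ℤ) (S : Set M) :
    μ ((R ^ k) ⁻¹' S) = μ S :=
  (measurePreserving_zpow hinv k).measure_preimage_equiv (f := (R ^ k).toMeasurableEquiv) S

theorem measure_orbitSaturation_eq_zero (hinv : MeasurePreserving R μ μ) (hA : μ A = 0) :
    μ (orbitSaturation R A) = 0 := by
  rw [orbitSaturation_eq_iUnion_preimage]
  exact measure_iUnion_null fun k => (measure_zpow_preimage hinv k A).trans hA

theorem exists_forall_measure_biUnion_zpow_preimage_lt (hinv : MeasurePreserving R μ μ)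
    (u : Finset ℤ) {ε : ℝ≥0∞} (hε : ε ≠ 0) :
    ∃ δ : ℝ≥0∞, δ ≠ 0 ∧ ∀ D, μ D < δ → μ (⋃ k ∈ u, (R ^ k) ⁻¹' D) < ε := by
  refine ⟨ε / u.card, ENNReal.div_ne_zero.2 ⟨hε, ENNReal.natCast_ne_top _⟩, fun D hD => ?_⟩
  calc μ (⋃ k ∈ u, (R ^ k) ⁻¹' D) ≤ ∑ k ∈ u, μ ((R ^ k) ⁻¹' D) := measure_biUnion_finset_le _ _
    _ = u.card * μ D := by simp only [measure_zpow_preimage hinv, Finset.sum_const, nsmul_eq_mul]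
    _ < ε := ENNReal.mul_lt_of_lt_div' hD

theorem ReturnTimesExceed.measure_le {N : ℕ} (h : ReturnTimesExceed R N C)
    (hinv : MeasurePreserving R μ μ) (hC : MeasurableSet C) : (N + 1 : ℕ) * μ C ≤ μ univ := by
  calc (N + 1 : ℕ) * μ C = ∑ j ∈ Finset.range (N + 1), μ ((R ^ (j : ℤ)) ⁻¹' C) := by
        simp only [measure_zpow_preimage hinv, Finset.sum_const, Finset.card_range, nsmul_eq_mul]
    _ = μ (⋃ j ∈ Finset.range (N + 1), (R ^ (j : ℤ)) ⁻¹' C) :=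
        (measure_biUnion_finset h.pairwiseDisjoint fun j _ => measurable_zpow R j hC).symm
    _ ≤ μ univ := measure_mono (subset_univ _)

variable [IsFiniteMeasure μ]

theorem nullSingletonClass_of_measure_periodicPts_eq_zero [T1Space M]
    (hinv : MeasurePreserving R μ μ) (haper : μ (Function.periodicPts R) = 0) :
    NullSingletonClass μ where
  measure_singleton x := by
    by_contra hx
    obtain ⟨y, rfl, m, hm, hmy⟩ := hinv.conservative.exists_mem_iterate_mem
      (measurableSet_singleton x).nullMeasurableSet hx
    exact hx <| measure_mono_null (singleton_subset_iff.2 <|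
      Function.mk_mem_periodicPts (Nat.pos_of_ne_zero hm) hmy) haper

theorem exists_small_sweeping_subset [T2Space M] [SecondCountableTopology M]
    (hinv : MeasurePreserving R μ μ) (hA : MeasurableSet A) {δ : ℝ≥0∞} (hδ : δ ≠ 0) :
    ∃ C ⊆ A, MeasurableSet C ∧ μ C < δ ∧ A \ Function.periodicPts R ⊆ orbitSaturation R C := by
  obtain ⟨N, hN⟩ := ENNReal.exists_nat_mul_gt hδ (measure_ne_top μ univ)
  obtain ⟨C, hCA, hC, hret, hsat⟩ := exists_sweeping_subset R hA N
  refine ⟨C, hCA, hC, lt_of_not_ge fun hδC => hN.not_ge ?_, hsat⟩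
  calc N * δ ≤ (N + 1 : ℕ) * μ C := by gcongr; exact N.le_succ
    _ ≤ μ univ := hret.measure_le hinv hC

theorem ae_frequently_atTop_zpow_mem (hinv : MeasurePreserving R μ μ) (hC : MeasurableSet C) :
    ∀ᵐ x ∂μ, x ∈ orbitSaturation R C → ∃ᶠ k : ℤ in atTop, (R ^ k) x ∈ C := by
  have hrec := hinv.conservative.ae_mem_imp_frequently_image_mem hC.nullMeasurableSet
  filter_upwards [ae_all_iff.2 fun k =>
    (measurePreserving_zpow hinv k).quasiMeasurePreserving.ae hrec] with x hx hsat
  obtain ⟨k, hk⟩ := mem_orbitSaturation_iff.1 hsat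
  have hfreq := hx k hk
  simp only [← zpow_natCast_apply, ← zpow_add_apply] at hfreq
  exact (tendsto_atTop_add_const_right _ k tendsto_natCast_atTop_atTop).frequently hfreq

theorem ae_visitsInfinitelyOften (hinv : MeasurePreserving R μ μ) (hC : MeasurableSet C) :
    ∀ᵐ x ∂μ, x ∈ orbitSaturation R C → VisitsInfinitelyOften R C x := by
  have hinv' : MeasurePreserving (R⁻¹ : M ≃ₜ M) μ μ := by
    simpa only [zpow_neg_one] using measurePreserving_zpow hinv (-1)
  filter_upwards [ae_frequently_atTop_zpow_mem hinv hC, ae_frequently_atTop_zpow_mem hinv' hC]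
    with x hfwd hbwd hx
  rw [orbitSaturation_inv] at hbwd
  simp only [inv_zpow'] at hbwd
  exact ⟨hfwd hx, tendsto_neg_atTop_atBot.frequently (hbwd hx)⟩

theorem exists_forall_measure_orbitSaturation_sdiff_lt (hinv : MeasurePreserving R μ μ)
    (hC : MeasurableSet C) {ε : ℝ≥0∞} (hε : ε ≠ 0) :
    ∃ δ : ℝ≥0∞, δ ≠ 0 ∧ ∀ K, μ (C \ K) < δ →
      μ (orbitSaturation R C \ orbitSaturation R K) < ε := by
  have hε2 : ε / 2 ≠ 0 := (ENNReal.half_pos hε).ne'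
  obtain ⟨u, hu⟩ := exists_finset_measure_sdiff_biUnion_lt
    (measurableSet_orbitSaturation hC).nullMeasurableSet (measure_ne_top μ _)
    (fun k : ℤ => (measurable_zpow R k hC).nullMeasurableSet)
    (by rw [← orbitSaturation_eq_iUnion_preimage, sdiff_self, measure_empty]) hε2
  obtain ⟨δ, hδ, hδu⟩ := exists_forall_measure_biUnion_zpow_preimage_lt hinv u hε2
  refine ⟨δ, hδ, fun K hK => ?_⟩
  have hsub : orbitSaturation R C \ orbitSaturation R K ⊆
      (orbitSaturation R C \ ⋃ k ∈ u, (R ^ k) ⁻¹' C) ∪ ⋃ k ∈ u, (R ^ k) ⁻¹' (C \ K) := by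
    rintro x ⟨hxC, hxK⟩
    by_cases hx : x ∈ ⋃ k ∈ u, (R ^ k) ⁻¹' C
    · obtain ⟨k, hk, hkC⟩ := mem_iUnion₂.1 hx
      exact Or.inr <| mem_iUnion₂.2
        ⟨k, hk, hkC, fun hkK => hxK (mem_orbitSaturation_iff.2 ⟨k, hkK⟩)⟩
    · exact Or.inl ⟨hxC, hx⟩
  calc μ (orbitSaturation R C \ orbitSaturation R K)
      ≤ _ + _ := (measure_mono hsub).trans (measure_union_le _ _)
    _ < ε / 2 + ε / 2 := ENNReal.add_lt_add hu (hδu _ hK)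
    _ = ε := ENNReal.add_halves ε

theorem exists_forall_measure_pos_and_orbitSaturation_sdiff_lt (hinv : MeasurePreserving R μ μ)
    (hA : μ A ≠ 0) (hC : MeasurableSet C) (hAC : μ (A \ orbitSaturation R C) = 0) {ε : ℝ≥0∞}
    (hε : ε ≠ 0) : ∃ δ : ℝ≥0∞, δ ≠ 0 ∧ ∀ K, μ (C \ K) < δ →
      0 < μ K ∧ μ (orbitSaturation R A \ orbitSaturation R K) < ε := by
  have hC0 : μ C ≠ 0 := fun hC0 => hA <| by
    rwa [measure_sdiff_null (measure_orbitSaturation_eq_zero hinv hC0)] at hAC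
  have hsatAC : μ (orbitSaturation R A \ orbitSaturation R C) = 0 :=
    measure_mono_null (orbitSaturation_sdiff_subset R A C)
      (measure_orbitSaturation_eq_zero hinv hAC)
  obtain ⟨δ, hδ, hδK⟩ := exists_forall_measure_orbitSaturation_sdiff_lt hinv hC hε
  refine ⟨min δ (μ C), (lt_min (pos_iff_ne_zero.2 hδ) (pos_iff_ne_zero.2 hC0)).ne',
    fun K hK => ⟨pos_iff_ne_zero.2 fun hK0 => ?_, ?_⟩⟩
  · exact (measure_sdiff_null (s := C) hK0 ▸ hK.trans_le (min_le_right _ _)).false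
  · calc μ (orbitSaturation R A \ orbitSaturation R K)
        ≤ μ (orbitSaturation R A \ orbitSaturation R C) +
            μ (orbitSaturation R C \ orbitSaturation R K) :=
          (measure_mono (sdiff_triangle _ _ _)).trans (measure_union_le _ _)
      _ < ε := by
          rw [hsatAC, zero_add]
          exact hδK K (hK.trans_le (min_le_left _ _))

end InvariantMeasure

section Support

variable {M : Type*} [TopologicalSpace M] [MeasurableSpace M] [OpensMeasurableSpace M]
  {μ : Measure M} {K : Set M}

theorem mem_support_restrict_iff_forall {x : M} :
    x ∈ (μ.restrict K).support ↔ ∀ U ∈ 𝓝 x, 0 < μ (U ∩ K) := by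
  rw [Measure.mem_support_restrict]
  exact (nhdsWithin_hasBasis (𝓝 x).basis_sets K).frequently_smallSets pos_mono

theorem measure_sdiff_support_restrict [HereditarilyLindelofSpace M] (hK : IsClosed K) :
    μ (K \ (μ.restrict K).support) = 0 := by
  rw [← Measure.measure_compl_support (μ := μ.restrict K),
    Measure.restrict_apply' hK.measurableSet, sdiff_eq, inter_comm]

theorem support_restrict_subset_of_isClosed (hK : IsClosed K) : (μ.restrict K).support ⊆ K :=
  (Measure.support_restrict_subset.trans inter_subset_left).trans hK.closure_subset

theorem restrict_support_restrict [HereditarilyLindelofSpace M] (hK : IsClosed K) :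
    μ.restrict (μ.restrict K).support = μ.restrict K :=
  Measure.restrict_congr_set <| (support_restrict_subset_of_isClosed hK).eventuallyLE.antisymm <|
    ae_le_set.2 (measure_sdiff_support_restrict hK)

theorem preperfect_of_subset_support_restrict [NullSingletonClass μ]
    (hK : K ⊆ (μ.restrict K).support) : Preperfect K := fun x hx => by
  refine accPt_iff_nhds.2 fun U hU => ?_
  by_contra! hsub
  have hpos : 0 < μ (U ∩ K) := mem_support_restrict_iff_forall.1 (hK hx) U hU
  exact hpos.ne' (measure_mono_null hsub (measure_singleton x))

end Support

section LongRuns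

variable {M : Type*} [TopologicalSpace M] {R : M ≃ₜ M} {K Z : Set M} {x : M}

theorem VisitsInfinitelyOften.exists_zpow_natCast_mem (h : VisitsInfinitelyOften R Z x) (N : ℕ) :
    ∃ n : ℕ, N ≤ n ∧ (R ^ (n : ℤ)) x ∈ Z := by
  obtain ⟨k, hNk, hk⟩ := frequently_atTop.1 h.1 N
  lift k to ℕ using by omega
  exact ⟨k, by exact_mod_cast hNk, hk⟩

theorem VisitsInfinitelyOften.exists_zpow_neg_natCast_mem (h : VisitsInfinitelyOften R Z x)
    (N : ℕ) : ∃ n : ℕ, N ≤ n ∧ (R ^ (-n : ℤ)) x ∈ Z := by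
  obtain ⟨k, hNk, hk⟩ := frequently_atBot.1 h.2 (-N)
  obtain ⟨n, rfl⟩ := Int.exists_eq_neg_ofNat (by omega : k ≤ 0)
  exact ⟨n, by omega, hk⟩

/-- The points whose first `p + 1` iterates, the point itself included, lie in `Z`. -/
def runSet (R : M ≃ₜ M) (Z : Set M) (p : ℕ) : Set M :=
  {x | ∀ j ≤ p, (R ^ (j : ℤ)) x ∈ Z}

theorem runSet_mono {Z' : Set M} (h : Z ⊆ Z') (p : ℕ) : runSet R Z p ⊆ runSet R Z' p :=
  fun _ hx j hj => h (hx j hj)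

theorem measurableSet_runSet [MeasurableSpace M] [BorelSpace M] (hZ : MeasurableSet Z) (p : ℕ) :
    MeasurableSet (runSet R Z p) := by
  simp only [runSet, ofPred_forall]
  exact .iInter fun j => .iInter fun _ => measurable_zpow R j hZ

/-- Arbitrarily far in the future and in the past, the orbit of `x` has arbitrarily long runs of
consecutive points in `Z`. -/
def HasLongRunsIn (R : M ≃ₜ M) (Z : Set M) (x : M) : Prop :=
  ∀ p : ℕ, VisitsInfinitelyOften R (runSet R Z p) x

theorem HasLongRunsIn.mono {Z' : Set M} (h : HasLongRunsIn R Z x) (hZ : Z ⊆ Z') :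
    HasLongRunsIn R Z' x :=
  fun p => (h p).mono (runSet_mono hZ p)

/-- The points of `K` that return to `K` at time `k` form a relatively open subset of `K`, for
every `k`. -/
def HasOpenReturns (R : M ≃ₜ M) (K : Set M) : Prop :=
  ∀ k : ℤ, ∃ O, IsOpen O ∧ K ∩ O = K ∩ (R ^ k) ⁻¹' K

theorem HasOpenReturns.support_restrict [MeasurableSpace M] [BorelSpace M] {μ : Measure M}
    (h : HasOpenReturns R K) (hK : IsClosed K) (hinv : MeasurePreserving R μ μ) :
    HasOpenReturns R (μ.restrict K).support := fun k => by
  obtain ⟨O, hO, hKO⟩ := h k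
  have hsub := support_restrict_subset_of_isClosed (μ := μ) hK
  refine ⟨O, hO, Subset.antisymm ?_ fun x hx => ?_⟩
  · rintro x ⟨hx, hxO⟩
    refine ⟨hx, mem_support_restrict_iff_forall.2 fun U hU => ?_⟩
    have hpos := mem_support_restrict_iff_forall.1 hx _ <| inter_mem (hO.mem_nhds hxO)
      ((R ^ k).continuous.continuousAt.preimage_mem_nhds hU)
    rw [← measure_zpow_preimage hinv k (U ∩ K)]
    refine hpos.trans_le (measure_mono fun y hy => ⟨hy.1.2, ?_⟩)
    exact (hKO.subset ⟨hy.2, hy.1.1⟩).2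
  · exact ⟨hx.1, (hKO.superset ⟨hsub hx.1, hsub hx.2⟩).2⟩

theorem HasOpenReturns.isDynamicallyCoherent (hK : HasOpenReturns R K) (hKZ : Disjoint K Z)
    (hruns : ∀ x ∈ K, HasLongRunsIn R Z x) : IsDynamicallyCoherent R K where
  isOpen_inter k := by
    obtain ⟨O, hO, hKO⟩ := hK (-k)
    refine ⟨O, hO, ?_⟩
    rw [← Subtype.preimage_coe_self_inter K O, hKO, image_zpow_eq_preimage, inter_comm]
  exists_forward p x hx := by
    obtain ⟨n, hn, hrun⟩ := (hruns x hx p).exists_zpow_natCast_mem 1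
    refine ⟨n, hn, fun j hj hjK => disjoint_left.1 hKZ hjK ?_⟩
    rw [add_comm, zpow_add_apply]
    exact hrun j hj
  exists_backward p x hx := by
    obtain ⟨n, hn, hrun⟩ := (hruns x hx p).exists_zpow_neg_natCast_mem (p + 1)
    refine ⟨n - p, by omega, fun j hj hjK => disjoint_left.1 hKZ hjK ?_⟩
    rw [show -((n - p : ℕ) : ℤ) - j = (p - j : ℕ) + -n by omega, zpow_add_apply]
    exact hrun (p - j) (Nat.sub_le p j)

theorem isDynamicallyMeagre_of_ae_mem_closure [MeasurableSpace M] [OpensMeasurableSpace M]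
    {μ : Measure M} (hK : K ⊆ (μ.restrict K).support) (hKZ : Disjoint K Z)
    (hacc : ∀ᵐ x ∂μ, x ∈ closure (range (fun k : ℤ => (R ^ k) x) ∩ Z)) :
    IsDynamicallyMeagre R K := by
  refine eq_empty_of_forall_notMem fun ⟨x, hxΛ⟩ hx => ?_
  have hxK : x ∈ K := mem_preimage.1 (interior_subset hx)
  obtain ⟨V, hV, hVK⟩ := mem_nhds_subtype _ _ _ |>.1 (mem_interior_iff_mem_nhds.1 hx)
  obtain ⟨W, hWV, hW, hxW⟩ := mem_nhds_iff.1 hV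
  have hpos : 0 < μ (W ∩ K) := mem_support_restrict_iff_forall.1 (hK hxK) W (hW.mem_nhds hxW)
  obtain ⟨y, ⟨hyW, hyK⟩, hy⟩ := ((frequently_ae_mem_iff.2 hpos.ne').and_eventually hacc).exists
  obtain ⟨_, hkW, ⟨k, rfl⟩, hkZ⟩ := mem_closure_iff.1 hy W hW hyW
  have hkΛ : (R ^ k) y ∈ closure (orbitSaturation R K) :=
    subset_closure ((zpow_mem_orbitSaturation_iff k).2 (subset_orbitSaturation hyK))
  have hkK : (R ^ k) y ∈ K := @hVK ⟨_, hkΛ⟩ (hWV hkW)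
  exact disjoint_left.1 hKZ hkK hkZ

end LongRuns

section Coherence

variable {M : Type*} [TopologicalSpace M] {R : M ≃ₜ M} {B C D S Z : Set M}

/-- The points whose orbit reaches `D`, in the future or in the past, before meeting `C`: cutting
orbits at their visits to `C`, this is the union of the resulting blocks that meet `D`. -/
def blockSaturation (R : M ≃ₜ M) (C D : Set M) : Set M :=
  {x | ∃ j : ℤ, (R ^ j) x ∈ D ∧ ∀ i ∈ uIcc 0 j, (R ^ i) x ∉ C}

theorem mem_blockSaturation_of_zpow_mem {x : M} {k : ℤ} (hk : ∀ i ∈ uIcc 0 k, (R ^ i) x ∉ C)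
    (h : (R ^ k) x ∈ blockSaturation R C D) : x ∈ blockSaturation R C D := by
  obtain ⟨j, hj, hjC⟩ := h
  rw [← zpow_add_apply] at hj
  refine ⟨j + k, hj, fun i hi => ?_⟩
  by_cases hik : i ∈ uIcc 0 k
  · exact hk i hik
  · have hij := hjC (i - k) (by rw [mem_uIcc] at hi hik ⊢; omega)
    rwa [← zpow_add_apply, sub_add_cancel] at hij

theorem sdiff_subset_blockSaturation : D \ C ⊆ blockSaturation R C D := fun x hx =>
  ⟨0, by simpa using hx.1, by simpa using hx.2⟩

theorem zpow_notMem_runSet_of_disjoint (hSZ : Disjoint S Z) {x : M} {k : ℤ} {m : ℕ}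
    (hk : k.natAbs ≤ m) (hx : x ∈ S) (hkx : (R ^ k) x ∈ S) :
    ∀ i ∈ uIcc 0 k, (R ^ i) x ∉ runSet R Z m := by
  intro i hi hrun
  rcases mem_uIcc.1 hi with ⟨hi0, hik⟩ | ⟨hki, hi0⟩
  · refine disjoint_left.1 hSZ hkx ?_
    have hmem := hrun (k - i).toNat (by omega)
    rwa [← zpow_add_apply, Int.toNat_of_nonneg (by omega), sub_add_cancel] at hmem
  · refine disjoint_left.1 hSZ hx ?_
    have hmem := hrun (-i).toNat (by omega)
    rwa [← zpow_add_apply, Int.toNat_of_nonneg (by omega), neg_add_cancel, zpow_zero] at hmem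

/-- `S'` is obtained from `S` by a removal that does not separate two points of `S` at most `m`
steps apart on the same orbit, and a set `D` is removed off which all visits to `S` are described
by closed sets. This is the inductive step in the construction of a closed set with open
returns. -/
structure IsCoherentRefinement (R : M ≃ₜ M) (m : ℕ) (S S' : Set M) : Prop where
  subset : S' ⊆ S
  zpow_mem : ∀ x ∈ S', ∀ k : ℤ, k.natAbs ≤ m → (R ^ k) x ∈ S → (R ^ k) x ∈ S'
  exists_isClosed_sdiff : ∃ D, Disjoint S' D ∧
    ∀ k : ℤ, IsClosed ((R ^ k) ⁻¹' S \ D) ∧ IsClosed (((R ^ k) ⁻¹' S)ᶜ \ D)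

section Limit

variable {T : ℕ → Set M} (hT : ∀ m, IsCoherentRefinement R m (T m) (T (m + 1)))

include hT

theorem zpow_mem_iInter_of_isCoherentRefinement {x : M} (hx : x ∈ ⋂ m, T m) {k : ℤ}
    (hk : (R ^ k) x ∈ T k.natAbs) : (R ^ k) x ∈ ⋂ m, T m := by
  refine mem_iInter.2 fun n => ?_
  rcases le_total n k.natAbs with hn | hn
  · exact antitone_nat_of_succ_le (fun m => (hT m).subset) hn hk
  · induction n, hn using Nat.le_induction with
    | base => exact hk
    | succ n hn ih => exact (hT n).zpow_mem x (mem_iInter.1 hx (n + 1)) k hn ih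

theorem isClosed_iInter_of_isCoherentRefinement : IsClosed (⋂ m, T m) := by
  choose D hD hclosed using fun m => (hT m).exists_isClosed_sdiff
  have heq : ⋂ m, T m = ⋂ m, T m \ D m := by
    refine Subset.antisymm (fun x hx => mem_iInter.2 fun m => ?_)
      (iInter_mono fun m => sdiff_subset)
    exact ⟨mem_iInter.1 hx m, disjoint_left.1 (hD m) (mem_iInter.1 hx (m + 1))⟩
  rw [heq]
  exact isClosed_iInter fun m => (hclosed m 0).1

theorem hasOpenReturns_iInter_of_isCoherentRefinement : HasOpenReturns R (⋂ m, T m) := fun k => by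
  obtain ⟨D, hD, hclosed⟩ := (hT k.natAbs).exists_isClosed_sdiff
  refine ⟨_, (hclosed k).2.isOpen_compl, ?_⟩
  ext x
  refine and_congr_right fun hx => ?_
  have hxD : x ∉ D := disjoint_left.1 hD (mem_iInter.1 hx _)
  calc x ∈ (((R ^ k) ⁻¹' T k.natAbs)ᶜ \ D)ᶜ ↔ (R ^ k) x ∈ T k.natAbs := by
        simp only [mem_compl_iff, Set.mem_sdiff, mem_preimage, hxD, not_false_eq_true, and_true,
          not_not]
    _ ↔ (R ^ k) x ∈ ⋂ m, T m :=
        ⟨zpow_mem_iInter_of_isCoherentRefinement hT hx, fun hk => mem_iInter.1 hk _⟩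

end Limit

variable [MeasurableSpace M] [BorelSpace M]

theorem measurableSet_blockSaturation (hC : MeasurableSet C) (hD : MeasurableSet D) :
    MeasurableSet (blockSaturation R C D) := by
  have heq : blockSaturation R C D =
      ⋃ j : ℤ, (R ^ j) ⁻¹' D ∩ ⋂ i ∈ uIcc 0 j, ((R ^ i) ⁻¹' C)ᶜ := by
    ext x
    simp only [blockSaturation, mem_ofPred_eq, mem_iUnion, mem_inter_iff, mem_iInter, mem_preimage,
      mem_compl_iff]
  rw [heq]
  exact .iUnion fun j => (measurable_zpow R j hD).inter
    (.biInter (to_countable _) fun i _ => (measurable_zpow R i hC).compl)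

variable {μ : Measure M} [IsFiniteMeasure μ]

theorem exists_forall_measure_blockSaturation_lt (hinv : MeasurePreserving R μ μ)
    (hC : MeasurableSet C) (hvisit : ∀ᵐ x ∂μ, VisitsInfinitelyOften R C x) {ε : ℝ≥0∞}
    (hε : ε ≠ 0) :
    ∃ δ : ℝ≥0∞, δ ≠ 0 ∧ ∀ D, μ D < δ → μ (blockSaturation R C D) < ε := by
  have hε2 : ε / 2 ≠ 0 := (ENNReal.half_pos hε).ne'
  let X : ℕ × ℕ → Set M := fun p => (R ^ (-p.1 : ℤ)) ⁻¹' C ∩ (R ^ (p.2 : ℤ)) ⁻¹' C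
  have hX : ∀ p, NullMeasurableSet (X p) μ := fun p =>
    ((measurable_zpow R _ hC).inter (measurable_zpow R _ hC)).nullMeasurableSet
  have hcover : μ (univ \ ⋃ p, X p) = 0 := by
    rw [← compl_eq_univ_sdiff]
    refine measure_mono_null (compl_subset_compl.2 fun x hx => ?_) (ae_iff.1 hvisit)
    obtain ⟨n, -, hn⟩ := VisitsInfinitelyOften.exists_zpow_neg_natCast_mem hx 0
    obtain ⟨m, -, hm⟩ := VisitsInfinitelyOften.exists_zpow_natCast_mem hx 0
    exact mem_iUnion.2 ⟨(n, m), hn, hm⟩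
  obtain ⟨u, hu⟩ := exists_finset_measure_sdiff_biUnion_lt .univ (measure_ne_top μ _) hX hcover hε2
  obtain ⟨δ, hδ, hδu⟩ := exists_forall_measure_biUnion_zpow_preimage_lt hinv
    (u.biUnion fun p => Finset.Ioo (-p.1 : ℤ) p.2) hε2
  refine ⟨δ, hδ, fun D hD => ?_⟩
  have hsub : blockSaturation R C D ⊆ (univ \ ⋃ p ∈ u, X p) ∪
      ⋃ k ∈ u.biUnion fun p => Finset.Ioo (-p.1 : ℤ) p.2, (R ^ k) ⁻¹' D := by
    rintro x ⟨j, hj, hjC⟩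
    by_cases hx : x ∈ ⋃ p ∈ u, X p
    · obtain ⟨p, hp, hp1, hp2⟩ := mem_iUnion₂.1 hx
      have hj1 : (-p.1 : ℤ) ∉ uIcc 0 j := fun hmem => hjC _ hmem hp1
      have hj2 : (p.2 : ℤ) ∉ uIcc 0 j := fun hmem => hjC _ hmem hp2
      rw [mem_uIcc] at hj1 hj2
      exact Or.inr <| mem_iUnion₂.2
        ⟨j, Finset.mem_biUnion.2 ⟨p, hp, Finset.mem_Ioo.2 ⟨by omega, by omega⟩⟩, hj⟩
    · exact Or.inl ⟨mem_univ x, hx⟩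
  calc μ (blockSaturation R C D) ≤ _ + _ := (measure_mono hsub).trans (measure_union_le _ _)
    _ < ε / 2 + ε / 2 := ENNReal.add_lt_add hu (hδu _ hD)
    _ = ε := ENNReal.add_halves ε

section Exists

variable [μ.WeaklyRegular] (hinv : MeasurePreserving R μ μ) (hZ : MeasurableSet Z)
  (hruns : ∀ᵐ x ∂μ, HasLongRunsIn R Z x)

include hinv hZ hruns

theorem exists_isCoherentRefinement (hS : MeasurableSet S) (hSZ : Disjoint S Z) (m : ℕ)
    {ε : ℝ≥0∞} (hε : ε ≠ 0) :
    ∃ S', MeasurableSet S' ∧ IsCoherentRefinement R m S S' ∧ μ (S \ S') < ε := by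
  have hC := measurableSet_runSet (R := R) hZ m
  obtain ⟨δ, hδ, hblock⟩ := exists_forall_measure_blockSaturation_lt hinv hC
    (hruns.mono fun x hx => hx m) hε
  obtain ⟨D, hD, hDμ, hclosed⟩ := exists_isOpen_measure_lt_forall_isClosed_sdiff (μ := μ)
    (fun k : ℤ => measurable_zpow R k hS) hδ
  have hSC : ∀ x ∈ S, x ∉ runSet R Z m := fun x hx => by
    simpa using zpow_notMem_runSet_of_disjoint hSZ (R := R) (k := 0) m.zero_le hx (by simpa)
  refine ⟨S \ blockSaturation R (runSet R Z m) D,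
    hS.diff (measurableSet_blockSaturation hC hD.measurableSet), ⟨sdiff_subset, ?_, D, ?_, hclosed⟩,
    ?_⟩
  · exact fun x hx k hk hkS => ⟨hkS, fun hkx => hx.2 <| mem_blockSaturation_of_zpow_mem
      (zpow_notMem_runSet_of_disjoint hSZ hk hx.1 hkS) hkx⟩
  · exact disjoint_left.2 fun x hx hxD => hx.2 (sdiff_subset_blockSaturation ⟨hxD, hSC x hx.1⟩)
  · rw [sdiff_sdiff_right_self]
    exact (measure_mono inter_subset_right).trans_lt (hblock D hDμ)

theorem exists_isClosed_hasOpenReturns_subset (hB : MeasurableSet B) (hBZ : Disjoint B Z)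
    {ε : ℝ≥0∞} (hε : ε ≠ 0) :
    ∃ K ⊆ B, IsClosed K ∧ HasOpenReturns R K ∧ μ (B \ K) < ε := by
  obtain ⟨δ, hδ0, hδ⟩ := ENNReal.exists_pos_sum_of_countable' hε ℕ
  have hstep : ∀ (m : ℕ) (S : {S : Set M // MeasurableSet S ∧ S ⊆ B}),
      ∃ S' : {S : Set M // MeasurableSet S ∧ S ⊆ B},
        IsCoherentRefinement R m S S' ∧ μ (S.1 \ S') < δ m := by
    rintro m ⟨S, hS, hSB⟩
    obtain ⟨S', hS', href, hμ⟩ :=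
      exists_isCoherentRefinement hinv hZ hruns hS (hBZ.mono_left hSB) m (hδ0 m).ne'
    exact ⟨⟨S', hS', href.subset.trans hSB⟩, href, hμ⟩
  choose next href hμ using hstep
  let T : ℕ → {S : Set M // MeasurableSet S ∧ S ⊆ B} := fun n => Nat.rec ⟨B, hB, Subset.rfl⟩ next n
  have hT : ∀ m, IsCoherentRefinement R m (T m).1 (T (m + 1)).1 := fun m => href m (T m)
  refine ⟨⋂ m, (T m).1, iInter_subset _ 0, isClosed_iInter_of_isCoherentRefinement hT,
    hasOpenReturns_iInter_of_isCoherentRefinement hT, ?_⟩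
  calc μ (B \ ⋂ m, (T m).1) ≤ ∑' m, μ ((T m).1 \ T (m + 1)) :=
        measure_sdiff_iInter_le_tsum μ fun m => (T m).1
    _ ≤ ∑' m, δ m := ENNReal.tsum_le_tsum fun m => (hμ m (T m)).le
    _ < ε := hδ

end Exists

end Coherence

section Rectangles

variable {d : ℕ} {X Y : Type*} [TopologicalSpace X] [TopologicalSpace Y]

theorem IsRectangle.of_homeomorph {s : Set X} {t : Set Y} (hs : IsRectangle d s) (e : s ≃ₜ t) :
    IsRectangle d t :=
  hs.map e.symm.trans

theorem IsRectangle.isCompact {s : Set X} (hs : IsRectangle d s) : IsCompact s := by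
  obtain ⟨e⟩ := hs
  have : CompactSpace (closedBall (0 : EuclideanSpace ℝ (Fin d)) 1) :=
    isCompact_iff_compactSpace.1 (isCompact_closedBall _ _)
  exact isCompact_iff_compactSpace.2 e.symm.compactSpace

theorem isRectangle_closedBall (x : EuclideanSpace ℝ (Fin d)) {r : ℝ} (hr : 0 < r) :
    IsRectangle d (closedBall x r) := by
  let h := (Homeomorph.smulOfNeZero r hr.ne').trans (Homeomorph.addLeft x)
  have himage : h '' closedBall (0 : EuclideanSpace ℝ (Fin d)) 1 = closedBall x r := by
    rw [← affinity_unitClosedBall hr.le x, ← image_vadd, ← image_smul, image_image]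
    rfl
  exact ⟨((h.image _).trans (Homeomorph.setCongr himage)).symm⟩

end Rectangles

section RectangleFamily

variable {d : ℕ} {M : Type*} [MetricSpace M] {η : ℝ} {E E' : Set (Set M)} {K : Set M}

/-- A finite family of pairwise disjoint rectangles in which any two points of the same rectangle
are at distance less than `η`. -/
structure IsRectangleFamily (d : ℕ) (η : ℝ) (E : Set (Set M)) : Prop where
  finite : E.Finite
  pairwiseDisjoint : E.PairwiseDisjoint id
  isRectangle : ∀ X ∈ E, IsRectangle d X
  dist_lt : ∀ X ∈ E, ∀ x ∈ X, ∀ y ∈ X, dist x y < η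

theorem isRectangleFamily_empty : IsRectangleFamily d η (∅ : Set (Set M)) :=
  ⟨finite_empty, pairwiseDisjoint_empty, by simp, by simp⟩

namespace IsRectangleFamily

theorem subset (hE : IsRectangleFamily d η E) (h : E' ⊆ E) : IsRectangleFamily d η E' where
  finite := hE.finite.subset h
  pairwiseDisjoint := hE.pairwiseDisjoint.subset h
  isRectangle X hX := hE.isRectangle X (h hX)
  dist_lt X hX := hE.dist_lt X (h hX)

theorem mono {η' : ℝ} (hE : IsRectangleFamily d η E) (h : η ≤ η') : IsRectangleFamily d η' E where
  __ := hE
  dist_lt X hX x hx y hy := (hE.dist_lt X hX x hx y hy).trans_le h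

theorem union (hE : IsRectangleFamily d η E) (hE' : IsRectangleFamily d η E')
    (h : Disjoint (⋃₀ E) (⋃₀ E')) : IsRectangleFamily d η (E ∪ E') where
  finite := hE.finite.union hE'.finite
  pairwiseDisjoint := pairwiseDisjoint_union.2 ⟨hE.pairwiseDisjoint, hE'.pairwiseDisjoint,
    fun _ hX _ hY _ => h.mono (subset_sUnion_of_mem hX) (subset_sUnion_of_mem hY)⟩
  isRectangle _ hX := hX.elim (hE.isRectangle _) (hE'.isRectangle _)
  dist_lt _ hX := hX.elim (hE.dist_lt _) (hE'.dist_lt _)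

theorem isCompact_sUnion (hE : IsRectangleFamily d η E) : IsCompact (⋃₀ E) :=
  hE.finite.isCompact_sUnion fun X hX => (hE.isRectangle X hX).isCompact

theorem subset_of_isPreconnected (hE : IsRectangleFamily d η E) {S X : Set M} (hX : X ∈ E)
    (hS : IsPreconnected S) (hSE : S ⊆ ⋃₀ E) (hSX : (S ∩ X).Nonempty) : S ⊆ X := by
  have hdisj : Disjoint X (⋃₀ (E \ {X})) :=
    disjoint_sUnion_right.2 fun Y hY => hE.pairwiseDisjoint hX hY.1 (Ne.symm hY.2)
  have hcover : S ⊆ X ∪ ⋃₀ (E \ {X}) := by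
    rwa [← sUnion_insert, insert_sdiff_singleton, insert_eq_of_mem hX]
  have hXclosed : IsClosed X := (hE.isRectangle X hX).isCompact.isClosed
  rcases isPreconnected_iff_subset_of_disjoint_closed.1 hS X _ hXclosed
    (hE.subset sdiff_subset).isCompact_sUnion.isClosed hcover (by rw [hdisj.inter_eq, inter_empty])
    with h | h
  · exact h
  · obtain ⟨x, hxS, hxX⟩ := hSX
    exact (disjoint_left.1 hdisj hxX (h hxS)).elim

end IsRectangleFamily

theorem isTotallyDisconnected_of_forall_isRectangleFamily
    (h : ∀ η > 0, ∃ E : Set (Set M), IsRectangleFamily d η E ∧ K ⊆ ⋃₀ E) :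
    IsTotallyDisconnected K := by
  intro S hSK hS x hx y hy
  by_contra hne
  obtain ⟨E, hE, hKE⟩ := h _ (dist_pos.2 hne)
  obtain ⟨X, hX, hxX⟩ := hKE (hSK hx)
  have hSX : S ⊆ X := hE.subset_of_isPreconnected hX hS (hSK.trans hKE) ⟨x, hx, hxX⟩
  exact lt_irrefl _ (hE.dist_lt X hX x hxX y (hSX hy))

theorem isTamelyEmbedded_of_forall_isRectangleFamily (hK : IsCompact K)
    (h : ∀ η > 0, ∃ E : Set (Set M), IsRectangleFamily d η E ∧ K ⊆ interior (⋃₀ E)) :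
    IsTamelyEmbedded d K := by
  intro U hU hKU
  obtain ⟨η, hη, hηU⟩ := hK.exists_thickening_subset_open hU hKU
  obtain ⟨E, hE, hKE⟩ := h η hη
  have hE' : IsRectangleFamily d η {X ∈ E | (X ∩ K).Nonempty} := hE.subset (sep_subset _ _)
  refine ⟨_, hE'.finite, hE'.isRectangle, hE'.pairwiseDisjoint, fun x hx => ?_, ?_⟩
  · have hfar : IsClosed (⋃₀ {X ∈ E | ¬ (X ∩ K).Nonempty}) :=
      (hE.subset (sep_subset _ _)).isCompact_sUnion.isClosed
    refine mem_interior.2 ⟨_, ?_, isOpen_interior.sdiff hfar, hKE hx, ?_⟩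
    · rintro y ⟨hy, hyfar⟩
      obtain ⟨X, hX, hyX⟩ := interior_subset hy
      exact ⟨X, ⟨hX, by_contra fun hXK => hyfar ⟨X, ⟨hX, hXK⟩, hyX⟩⟩, hyX⟩
    · rintro ⟨X, ⟨-, hXK⟩, hxX⟩
      exact hXK ⟨x, hxX, hx⟩
  · rintro y ⟨X, ⟨hX, z, hzX, hzK⟩, hyX⟩
    exact hηU (mem_thickening_iff.2 ⟨z, hzK, hE.dist_lt X hX y hyX z hzX⟩)

end RectangleFamily

section Besicovitch

variable {α : Type*} [MetricSpace α] [MeasurableSpace α] [OpensMeasurableSpace α] (ν : Measure α)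

theorem exists_closedBall_subset_measure_sphere_eq_zero [SFinite ν] {x : α} {V : Set α}
    (hV : V ∈ 𝓝 x) {ε : ℝ} (hε : 0 < ε) :
    ∃ r ∈ Ioo 0 ε, closedBall x r ⊆ V ∧ ν (sphere x r) = 0 := by
  obtain ⟨ρ, hρ, hρV⟩ := Metric.mem_nhds_iff.1 hV
  have hcount : {r : ℝ | 0 < ν (sphere x r)}.Countable :=
    Measure.countable_meas_level_set_pos (μ := ν) (g := fun y => dist y x) (by fun_prop)
  obtain ⟨r, hr, hr0, hrlt⟩ := (hcount.dense_compl ℝ).exists_between (lt_min hε hρ)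
  refine ⟨r, ⟨hr0, hrlt.trans_le (min_le_left _ _)⟩, ?_, nonpos_iff_eq_zero.1 (not_lt.1 hr)⟩
  exact (closedBall_subset_ball (hrlt.trans_le (min_le_right _ _))).trans hρV

theorem exists_finset_pairwiseDisjoint_closedBall [SecondCountableTopology α]
    [HasBesicovitchCovering α] [IsFiniteMeasure ν] {s : Set α} (hs : MeasurableSet s)
    {V : α → Set α} (hV : ∀ x ∈ s, V x ∈ 𝓝 x) {δ : ℝ≥0∞} (hδ : δ ≠ 0) :
    ∃ (t : Finset α) (r : α → ℝ),
      (∀ x ∈ t, 0 < r x ∧ closedBall x (r x) ⊆ V x ∧ ν (sphere x (r x)) = 0) ∧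
      (t : Set α).PairwiseDisjoint (fun x => closedBall x (r x)) ∧
      ν (s \ ⋃ x ∈ t, closedBall x (r x)) < δ := by
  classical
  obtain ⟨t, r, htc, -, hr, htν, hdisj⟩ := Besicovitch.exists_disjoint_closedBall_covering_ae ν
    (fun x => {r | closedBall x r ⊆ V x ∧ ν (sphere x r) = 0}) s
    (fun x hx ε hε => by
      obtain ⟨r, hr, hrV⟩ := exists_closedBall_subset_measure_sphere_eq_zero ν (hV x hx) hε
      exact ⟨r, hrV, hr⟩)
    (fun _ => 1) fun _ _ => one_pos
  have : Countable t := htc.to_subtype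
  rw [biUnion_eq_iUnion] at htν
  obtain ⟨u, hu⟩ := exists_finset_measure_sdiff_biUnion_lt hs.nullMeasurableSet
    (measure_ne_top ν s) (fun x : t => isClosed_closedBall.measurableSet.nullMeasurableSet) htν hδ
  refine ⟨u.map (Function.Embedding.subtype _), r, fun x hx => ?_, hdisj.subset ?_, ?_⟩
  · obtain ⟨y, -, rfl⟩ := Finset.mem_map.1 hx
    exact ⟨(hr y y.2).2.1, (hr y y.2).1⟩
  · rw [Finset.coe_map]
    rintro _ ⟨y, -, rfl⟩
    exact y.2
  · simpa using hu

end Besicovitch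

section Charts

variable {d : ℕ} {M : Type*} [MetricSpace M] {η : ℝ}
  (c : OpenPartialHomeomorph M (EuclideanSpace ℝ (Fin d)))
  {t : Finset (EuclideanSpace ℝ (Fin d))} {r : EuclideanSpace ℝ (Fin d) → ℝ}

theorem isRectangleFamily_image_symm_closedBall (hr : ∀ x ∈ t, 0 < r x)
    (hrc : ∀ x ∈ t, closedBall x (r x) ⊆ c.target ∩ c.symm ⁻¹' ball (c.symm x) (η / 2))
    (hdisj : (t : Set _).PairwiseDisjoint fun x => closedBall x (r x)) :
    IsRectangleFamily d η ((fun x => c.symm '' closedBall x (r x)) '' t) where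
  finite := t.finite_toSet.image _
  pairwiseDisjoint := by
    rintro _ ⟨x, hx, rfl⟩ _ ⟨y, hy, rfl⟩ hne
    have hxy : x ≠ y := fun h => hne (h ▸ rfl)
    exact (hdisj hx hy hxy).image c.symm.injOn
      ((hrc x hx).trans inter_subset_left) ((hrc y hy).trans inter_subset_left)
  isRectangle := by
    rintro _ ⟨x, hx, rfl⟩
    exact (isRectangle_closedBall x (hr x hx)).of_homeomorph
      (c.symm.homeomorphOfImageSubsetSource ((hrc x hx).trans inter_subset_left) rfl)
  dist_lt := by
    rintro _ ⟨x, hx, rfl⟩ _ ⟨y, hy, rfl⟩ _ ⟨z, hz, rfl⟩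
    linarith [dist_triangle_right (c.symm y) (c.symm z) (c.symm x),
      mem_ball.1 (hrc x hx hy).2, mem_ball.1 (hrc x hx hz).2]

theorem frontier_sUnion_image_symm_closedBall_subset
    (hrc : ∀ x ∈ t, closedBall x (r x) ⊆ c.target) :
    frontier (⋃₀ ((fun x => c.symm '' closedBall x (r x)) '' t)) ⊆
      ⋃ x ∈ t, c.symm '' sphere x (r x) := by
  have hclosed : IsClosed (⋃ x ∈ t, c.symm '' closedBall x (r x)) :=
    t.finite_toSet.isClosed_biUnion fun x hx =>
      ((isCompact_closedBall x (r x)).image_of_continuousOn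
        (c.symm.continuousOn.mono (hrc x hx))).isClosed
  rw [sUnion_image]
  simp only [SetLike.mem_coe, hclosed.frontier_eq]
  rintro y ⟨hy, hyint⟩
  obtain ⟨x, hx, z, hz, rfl⟩ := mem_iUnion₂.1 hy
  refine mem_iUnion₂.2 ⟨x, hx, z, le_antisymm hz (not_lt.1 fun hzlt => hyint ?_), rfl⟩
  have hopen : IsOpen (c.symm '' ball x (r x)) :=
    c.symm.isOpen_image_of_subset_source isOpen_ball (ball_subset_closedBall.trans (hrc x hx))
  exact mem_interior.2 ⟨_, (image_mono ball_subset_closedBall).trans (subset_iUnion₂_of_subset x hx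
    subset_rfl), hopen, mem_image_of_mem _ hzlt⟩

variable [MeasurableSpace M] [OpensMeasurableSpace M] (μ : Measure M)

theorem map_restrict_source_apply {S : Set (EuclideanSpace ℝ (Fin d))} (hS : MeasurableSet S) :
    (μ.restrict c.source).map c S = μ (c.source ∩ c ⁻¹' S) := by
  rw [Measure.map_apply_of_aemeasurable
    (c.continuousOn.aemeasurable c.open_source.measurableSet) hS,
    Measure.restrict_apply' c.open_source.measurableSet, inter_comm]

variable [IsFiniteMeasure μ]

theorem exists_isRectangleFamily_of_subset_source {V : Set M} (hV : IsOpen V)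
    (hVc : V ⊆ c.source) (hη : 0 < η) {δ : ℝ≥0∞} (hδ : δ ≠ 0) :
    ∃ E, IsRectangleFamily d η E ∧ ⋃₀ E ⊆ V ∧ μ (frontier (⋃₀ E)) = 0 ∧ μ (V \ ⋃₀ E) < δ := by
  let ν := (μ.restrict c.source).map c
  let s := c.target ∩ c.symm ⁻¹' V
  have hs : IsOpen s := c.isOpen_inter_preimage_symm hV
  have hU : ∀ x ∈ s, s ∩ (c.target ∩ c.symm ⁻¹' ball (c.symm x) (η / 2)) ∈ 𝓝 x := fun x hx =>
    (hs.inter (c.isOpen_inter_preimage_symm isOpen_ball)).mem_nhds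
      ⟨hx, hx.1, mem_ball_self (half_pos hη)⟩
  obtain ⟨t, r, hr, hdisj, htν⟩ :=
    exists_finset_pairwiseDisjoint_closedBall ν hs.measurableSet hU hδ
  have hrs : ∀ x ∈ t, closedBall x (r x) ⊆ s := fun x hx => (hr x hx).2.1.trans inter_subset_left
  have hrt : ∀ x ∈ t, closedBall x (r x) ⊆ c.target := fun x hx =>
    (hrs x hx).trans inter_subset_left
  refine ⟨_, isRectangleFamily_image_symm_closedBall c (fun x hx => (hr x hx).1)
    (fun x hx => (hr x hx).2.1.trans inter_subset_right) hdisj, ?_, ?_, ?_⟩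
  · rintro _ ⟨_, ⟨x, hx, rfl⟩, y, hy, rfl⟩
    exact (hrs x hx hy).2
  · refine measure_mono_null (frontier_sUnion_image_symm_closedBall_subset c hrt) <|
      (measure_biUnion_null_iff t.countable_toSet).2 fun x hx => ?_
    rw [c.symm_image_eq_source_inter_preimage (sphere_subset_closedBall.trans (hrt x hx)),
      ← map_restrict_source_apply c μ isClosed_sphere.measurableSet]
    exact (hr x hx).2.2
  · have hmeas : MeasurableSet (s \ ⋃ x ∈ t, closedBall x (r x)) :=
      hs.measurableSet.diff (t.measurableSet_biUnion fun x _ => isClosed_closedBall.measurableSet)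
    rw [map_restrict_source_apply c μ hmeas] at htν
    refine (measure_mono ?_).trans_lt htν
    rintro y ⟨hyV, hyE⟩
    have hyc := hVc hyV
    refine ⟨hyc, ⟨c.map_source hyc, by rwa [mem_preimage, c.left_inv hyc]⟩, fun hy => hyE ?_⟩
    obtain ⟨x, hx, hyx⟩ := mem_iUnion₂.1 hy
    exact ⟨_, mem_image_of_mem _ hx, c y, hyx, c.left_inv hyc⟩

theorem exists_isRectangleFamily_of_finset {ι : Type*}
    (c : ι → OpenPartialHomeomorph M (EuclideanSpace ℝ (Fin d))) (hη : 0 < η) (t : Finset ι)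
    {δ : ℝ≥0∞} (hδ : δ ≠ 0) :
    ∃ E, IsRectangleFamily d η E ∧ μ (frontier (⋃₀ E)) = 0 ∧
      μ ((⋃ i ∈ t, (c i).source) \ ⋃₀ E) < δ := by
  classical
  induction t using Finset.induction_on generalizing δ with
  | empty => exact ⟨∅, isRectangleFamily_empty, by simp, by simpa using pos_iff_ne_zero.2 hδ⟩
  | insert a t _ ih =>
    have hδ2 : δ / 2 ≠ 0 := (ENNReal.half_pos hδ).ne'
    obtain ⟨E, hE, hEfr, hEμ⟩ := ih hδ2
    obtain ⟨E', hE', hE'V, hE'fr, hE'μ⟩ := exists_isRectangleFamily_of_subset_source (c a) μ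
      ((c a).open_source.sdiff hE.isCompact_sUnion.isClosed) sdiff_subset hη hδ2
    refine ⟨E ∪ E', hE.union hE' (disjoint_sdiff_right.mono_right hE'V), ?_, ?_⟩
    · rw [sUnion_union]
      exact measure_mono_null ((frontier_union_subset _ _).trans
        (union_subset_union inter_subset_left inter_subset_right)) (measure_union_null hEfr hE'fr)
    · rw [sUnion_union, Finset.set_biUnion_insert]
      calc μ (((c a).source ∪ ⋃ i ∈ t, (c i).source) \ (⋃₀ E ∪ ⋃₀ E'))
          ≤ μ ((⋃ i ∈ t, (c i).source) \ ⋃₀ E) + μ (((c a).source \ ⋃₀ E) \ ⋃₀ E') :=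
            (measure_mono (by grind)).trans (measure_union_le _ _)
        _ < δ / 2 + δ / 2 := ENNReal.add_lt_add hEμ hE'μ
        _ = δ := ENNReal.add_halves δ

end Charts

section ChartedSpace

variable (d : ℕ) {M : Type*} [MetricSpace M] [SecondCountableTopology M]
  [ChartedSpace (EuclideanSpace ℝ (Fin d)) M] [MeasurableSpace M] [OpensMeasurableSpace M]
  (μ : Measure M) [IsFiniteMeasure μ]

theorem exists_isRectangleFamily_measure_compl_interior_lt {η : ℝ} (hη : 0 < η) {δ : ℝ≥0∞}
    (hδ : δ ≠ 0) :
    ∃ E : Set (Set M), IsRectangleFamily d η E ∧ μ (interior (⋃₀ E))ᶜ < δ := by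
  have hδ2 : δ / 2 ≠ 0 := (ENNReal.half_pos hδ).ne'
  obtain ⟨s, hs, hsM⟩ := TopologicalSpace.countable_cover_nhds
    (chart_source_mem_nhds (EuclideanSpace ℝ (Fin d)) (M := M))
  have : Countable s := hs.to_subtype
  let c : s → OpenPartialHomeomorph M (EuclideanSpace ℝ (Fin d)) := fun x => chartAt _ x.1
  obtain ⟨t, ht⟩ := exists_finset_measure_sdiff_biUnion_lt (X := fun x => (c x).source)
    MeasurableSet.univ.nullMeasurableSet
    (measure_ne_top μ _) (fun x => (c x).open_source.measurableSet.nullMeasurableSet)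
    (by rw [← biUnion_eq_iUnion s fun x _ => (chartAt _ x).source, hsM, Set.sdiff_self,
      measure_empty])
    hδ2
  obtain ⟨E, hE, hfr, hEμ⟩ := exists_isRectangleFamily_of_finset μ c hη t hδ2
  refine ⟨E, hE, ?_⟩
  have hsub : (interior (⋃₀ E))ᶜ ⊆ (univ \ ⋃ x ∈ t, (c x).source) ∪
      ((⋃ x ∈ t, (c x).source) \ ⋃₀ E) ∪ frontier (⋃₀ E) := by
    rw [hE.isCompact_sUnion.isClosed.frontier_eq]
    grind
  calc μ (interior (⋃₀ E))ᶜ ≤ μ (univ \ ⋃ x ∈ t, (c x).source) +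
        μ ((⋃ x ∈ t, (c x).source) \ ⋃₀ E) + μ (frontier (⋃₀ E)) :=
          (measure_mono hsub).trans <| (measure_union_le _ _).trans <|
            add_le_add_left (measure_union_le _ _) _
    _ < δ / 2 + δ / 2 := by
      rw [hfr, add_zero]
      exact ENNReal.add_lt_add ht hEμ
    _ = δ := ENNReal.add_halves δ

theorem exists_forall_isRectangleFamily_compl_subset {δ : ℝ≥0∞} (hδ : δ ≠ 0) :
    ∃ Z : Set M, MeasurableSet Z ∧ μ Z < δ ∧
      ∀ η > 0, ∃ E : Set (Set M), IsRectangleFamily d η E ∧ Zᶜ ⊆ interior (⋃₀ E) := by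
  obtain ⟨δ', hδ_pos, hδ'⟩ := ENNReal.exists_pos_sum_of_countable' hδ ℕ
  choose E hE hEμ using fun n : ℕ => exists_isRectangleFamily_measure_compl_interior_lt d μ
    (Nat.one_div_pos_of_nat (α := ℝ) (n := n)) (hδ_pos n).ne'
  refine ⟨⋃ n, (interior (⋃₀ E n))ᶜ, .iUnion fun n => isOpen_interior.measurableSet.compl,
    (measure_iUnion_le _).trans_lt ((ENNReal.tsum_le_tsum fun n => (hEμ n).le).trans_lt hδ'),
    fun η hη => ?_⟩
  obtain ⟨n, hn⟩ := exists_nat_one_div_lt hη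
  exact ⟨E n, (hE n).mono hn.le, compl_subset_comm.1 (subset_iUnion_of_subset n subset_rfl)⟩

end ChartedSpace

section ExceptionalSets

variable {M : Type*} [TopologicalSpace M] [T2Space M] [SecondCountableTopology M]
  [MeasurableSpace M] [BorelSpace M] {R : M ≃ₜ M} {μ : Measure M} [IsFiniteMeasure μ]
  (hinv : MeasurePreserving R μ μ) (haper : μ (Function.periodicPts R) = 0)

include hinv haper

theorem exists_small_ae_visitsInfinitelyOften_runSet (p : ℕ) {δ : ℝ≥0∞} (hδ : δ ≠ 0) :
    ∃ Z, MeasurableSet Z ∧ μ Z < δ ∧ ∀ᵐ x ∂μ, VisitsInfinitelyOften R (runSet R Z p) x := by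
  obtain ⟨C, -, hC, hCμ, hsat⟩ := exists_small_sweeping_subset hinv MeasurableSet.univ
    (δ := δ / (p + 1)) (ENNReal.div_ne_zero.2 ⟨hδ, by finiteness⟩)
  refine ⟨⋃ j ∈ Finset.range (p + 1), (R ^ (-j : ℤ)) ⁻¹' C,
    Finset.measurableSet_biUnion _ fun j _ => measurable_zpow R _ hC, ?_, ?_⟩
  · calc μ (⋃ j ∈ Finset.range (p + 1), (R ^ (-j : ℤ)) ⁻¹' C)
        ≤ ∑ j ∈ Finset.range (p + 1), μ ((R ^ (-j : ℤ)) ⁻¹' C) := measure_biUnion_finset_le _ _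
      _ = μ C * (p + 1) := by
        simp only [measure_zpow_preimage hinv, Finset.sum_const, nsmul_eq_mul, Finset.card_range,
          Nat.cast_add, Nat.cast_one, mul_comm]
      _ < δ := (ENNReal.lt_div_iff_mul_lt (.inl (by positivity)) (.inl (by finiteness))).1 hCμ
  · filter_upwards [ae_visitsInfinitelyOften hinv hC,
      measure_eq_zero_iff_ae_notMem.1 haper] with x hx hxp
    refine (hx (hsat ⟨mem_univ x, hxp⟩)).mono fun y hy j hj => ?_
    refine mem_iUnion₂.2 ⟨j, Finset.mem_range_succ_iff.2 hj, ?_⟩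
    rwa [mem_preimage, ← zpow_add_apply, neg_add_cancel, zpow_zero]

theorem exists_small_ae_hasLongRunsIn {δ : ℝ≥0∞} (hδ : δ ≠ 0) :
    ∃ Z, MeasurableSet Z ∧ μ Z < δ ∧ ∀ᵐ x ∂μ, HasLongRunsIn R Z x := by
  obtain ⟨δ', hδ_pos, hδ'⟩ := ENNReal.exists_pos_sum_of_countable' hδ ℕ
  choose Z hZ hZμ hvisit using fun p =>
    exists_small_ae_visitsInfinitelyOften_runSet hinv haper p (hδ_pos p).ne'
  refine ⟨⋃ p, Z p, .iUnion hZ, (measure_iUnion_le _).trans_lt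
    ((ENNReal.tsum_le_tsum fun p => (hZμ p).le).trans_lt hδ'), ?_⟩
  filter_upwards [ae_all_iff.2 hvisit] with x hx p
  exact (hx p).mono (runSet_mono (subset_iUnion Z p) p)

theorem exists_small_ae_mem_closure_orbit_inter {δ : ℝ≥0∞} (hδ : δ ≠ 0) :
    ∃ Z, MeasurableSet Z ∧ μ Z < δ ∧
      ∀ᵐ x ∂μ, x ∈ closure (range (fun k : ℤ => (R ^ k) x) ∩ Z) := by
  obtain ⟨b, hbc, -, hb⟩ := TopologicalSpace.exists_countable_basis M
  have : Countable b := hbc.to_subtype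
  obtain ⟨δ', hδ_pos, hδ'⟩ := ENNReal.exists_pos_sum_of_countable' hδ b
  choose C hCV hC hCμ hsat using fun V : b =>
    exists_small_sweeping_subset hinv (hb.isOpen V.2).measurableSet (hδ_pos V).ne'
  refine ⟨⋃ V, C V, .iUnion hC, (measure_iUnion_le _).trans_lt
    ((ENNReal.tsum_le_tsum fun V => (hCμ V).le).trans_lt hδ'), ?_⟩
  filter_upwards [measure_eq_zero_iff_ae_notMem.1 haper] with x hx
  refine hb.mem_closure_iff.2 fun V hV hxV => ?_
  obtain ⟨k, hk⟩ := mem_orbitSaturation_iff.1 (hsat ⟨V, hV⟩ ⟨hxV, hx⟩)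
  exact ⟨(R ^ k) x, hCV _ hk, mem_range_self k, mem_iUnion.2 ⟨_, hk⟩⟩

end ExceptionalSets

section Construction

variable {d : ℕ} {M : Type*} [MetricSpace M] [MeasurableSpace M] {R : M ≃ₜ M}
  {μ : Measure M} {B K Z : Set M}

/-- The conditions on a measurable set `Z`, to be chosen of small measure, under which closed sets
disjoint from `Z` with open returns are coherent, tame and meagre: orbits make long excursions
to `Z` and accumulate through `Z` at their own points, and the complement of `Z` is covered at
every scale by a finite family of rectangles. -/
structure IsExceptionalSet (d : ℕ) (R : M ≃ₜ M) (μ : Measure M) (Z : Set M) : Prop where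
  measurableSet : MeasurableSet Z
  ae_hasLongRunsIn : ∀ᵐ x ∂μ, HasLongRunsIn R Z x
  hasLongRunsIn_of_notMem : ∀ x ∉ Z, HasLongRunsIn R Z x
  ae_mem_closure : ∀ᵐ x ∂μ, x ∈ closure (range (fun k : ℤ => (R ^ k) x) ∩ Z)
  exists_isRectangleFamily : ∀ η > 0, ∃ E, IsRectangleFamily d η E ∧ Zᶜ ⊆ interior (⋃₀ E)

namespace IsExceptionalSet

theorem isCompact_of_isClosed (hZ : IsExceptionalSet d R μ Z) (hK : IsClosed K)
    (hKZ : Disjoint K Z) : IsCompact K := by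
  obtain ⟨E, hE, hZE⟩ := hZ.exists_isRectangleFamily 1 one_pos
  exact hE.isCompact_sUnion.of_isClosed_subset hK
    ((subset_compl_iff_disjoint_right.2 hKZ).trans (hZE.trans interior_subset))

theorem isTotallyDisconnected (hZ : IsExceptionalSet d R μ Z) (hKZ : Disjoint K Z) :
    IsTotallyDisconnected K :=
  isTotallyDisconnected_of_forall_isRectangleFamily fun η hη => by
    obtain ⟨E, hE, hZE⟩ := hZ.exists_isRectangleFamily η hη
    exact ⟨E, hE, (subset_compl_iff_disjoint_right.2 hKZ).trans (hZE.trans interior_subset)⟩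

theorem isTamelyEmbedded (hZ : IsExceptionalSet d R μ Z) (hK : IsClosed K)
    (hKZ : Disjoint K Z) : IsTamelyEmbedded d K :=
  isTamelyEmbedded_of_forall_isRectangleFamily (hZ.isCompact_of_isClosed hK hKZ) fun η hη => by
    obtain ⟨E, hE, hZE⟩ := hZ.exists_isRectangleFamily η hη
    exact ⟨E, hE, (subset_compl_iff_disjoint_right.2 hKZ).trans hZE⟩

variable [BorelSpace M]

theorem isCantorSet [NullSingletonClass μ] (hZ : IsExceptionalSet d R μ Z) (hK : IsClosed K)
    (hKZ : Disjoint K Z) (hKsupp : K ⊆ (μ.restrict K).support) (hKne : K.Nonempty) :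
    IsCantorSet K where
  nonempty := hKne
  metrizable := inferInstance
  isCompact := hZ.isCompact_of_isClosed hK hKZ
  isTotallyDisconnected := hZ.isTotallyDisconnected hKZ
  preperfect := preperfect_of_subset_support_restrict hKsupp

theorem exists_isClosed_subset_support (hZ : IsExceptionalSet d R μ Z) [SecondCountableTopology M]
    [IsFiniteMeasure μ] (hinv : MeasurePreserving R μ μ) (hB : MeasurableSet B)
    (hBZ : Disjoint B Z) {ε : ℝ≥0∞} (hε : ε ≠ 0) :
    ∃ K ⊆ B, IsClosed K ∧ K ⊆ (μ.restrict K).support ∧ HasOpenReturns R K ∧ μ (B \ K) < ε := by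
  obtain ⟨L, hLB, hL, hret, hLμ⟩ :=
    exists_isClosed_hasOpenReturns_subset hinv hZ.measurableSet hZ.ae_hasLongRunsIn hB hBZ hε
  refine ⟨(μ.restrict L).support, (support_restrict_subset_of_isClosed hL).trans hLB,
    Measure.isClosed_support, by rw [restrict_support_restrict hL],
    hret.support_restrict hL hinv, ?_⟩
  calc μ (B \ (μ.restrict L).support) ≤ μ (B \ L) + μ (L \ (μ.restrict L).support) :=
        (measure_mono (by grind)).trans (measure_union_le _ _)
    _ < ε := by rwa [measure_sdiff_support_restrict hL, add_zero]

end IsExceptionalSet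

theorem exists_isExceptionalSet [BorelSpace M] [SecondCountableTopology M] [IsFiniteMeasure μ]
    [ChartedSpace (EuclideanSpace ℝ (Fin d)) M] (hinv : MeasurePreserving R μ μ)
    (haper : μ (Function.periodicPts R) = 0) {δ : ℝ≥0∞} (hδ : δ ≠ 0) :
    ∃ Z, IsExceptionalSet d R μ Z ∧ μ Z < δ := by
  have hδ3 : δ / 3 ≠ 0 := ENNReal.div_ne_zero.2 ⟨hδ, by finiteness⟩
  obtain ⟨Z₁, hZ₁, hZ₁μ, hruns⟩ := exists_small_ae_hasLongRunsIn hinv haper hδ3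
  obtain ⟨Z₂, hZ₂, hZ₂μ, hacc⟩ := exists_small_ae_mem_closure_orbit_inter hinv haper hδ3
  obtain ⟨Z₃, hZ₃, hZ₃μ, hrect⟩ := exists_forall_isRectangleFamily_compl_subset d μ hδ3
  let Z₀ := toMeasurable μ {x | ¬ HasLongRunsIn R Z₁ x}
  have hZ₀μ : μ Z₀ = 0 := (measure_toMeasurable _).trans (ae_iff.1 hruns)
  refine ⟨Z₀ ∪ (Z₁ ∪ Z₂ ∪ Z₃), ⟨?_, ?_, fun x hx => ?_, ?_, fun η hη => ?_⟩, ?_⟩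
  · exact (measurableSet_toMeasurable _ _).union ((hZ₁.union hZ₂).union hZ₃)
  · exact hruns.mono fun x hx => hx.mono (by grind)
  · refine HasLongRunsIn.mono (by_contra fun hx' => hx (.inl ?_)) (by grind : Z₁ ⊆ _)
    exact subset_toMeasurable _ _ hx'
  · exact hacc.mono fun x hx => closure_mono (inter_subset_inter_right _ (by grind)) hx
  · obtain ⟨E, hE, hZE⟩ := hrect η hη
    exact ⟨E, hE, (compl_subset_compl.2 (by grind)).trans hZE⟩
  · calc μ (Z₀ ∪ (Z₁ ∪ Z₂ ∪ Z₃)) ≤ μ Z₀ + (μ Z₁ + μ Z₂ + μ Z₃) :=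
          (measure_union_le _ _).trans <| by
            gcongr
            exact (measure_union_le _ _).trans (by gcongr; exact measure_union_le _ _)
      _ < δ / 3 + δ / 3 + δ / 3 := by
        rw [hZ₀μ, zero_add]
        exact ENNReal.add_lt_add (ENNReal.add_lt_add hZ₁μ hZ₂μ) hZ₃μ
      _ = δ := ENNReal.add_thirds δ

end Construction

theorem propositionp_general (d : ℕ) {M : Type*} [TopologicalSpace M] [T2Space M]
    [SigmaCompactSpace M] [ChartedSpace (EuclideanSpace ℝ (Fin d)) M] [MeasurableSpace M]
    [BorelSpace M] (R : M ≃ₜ M) (μ : Measure M) [IsFiniteMeasure μ]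
    (hinv : MeasurePreserving R μ μ) (haper : μ (Function.periodicPts R) = 0) (A : Set M)
    (hA : MeasurableSet A) (hpos : 0 < μ A) (ε : ℝ) (hε : 0 < ε) :
    ∃ K : Set M, IsCantorSet K ∧ K ⊆ A ∧ IsDynamicallyCoherent R K ∧
      Disjoint K (R '' K) ∧ IsTamelyEmbedded d K ∧ IsDynamicallyMeagre R K ∧
      |μ.real (orbitSaturation R A) - μ.real (orbitSaturation R K)| < ε ∧ 0 < μ K := by
  have : SecondCountableTopology M :=
    ChartedSpace.secondCountable_of_sigmaCompact (EuclideanSpace ℝ (Fin d)) M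
  have : LocallyCompactSpace M := ChartedSpace.locallyCompactSpace (EuclideanSpace ℝ (Fin d)) M
  let _ : MetricSpace M := TopologicalSpace.metrizableSpaceMetric M
  have : NullSingletonClass μ := nullSingletonClass_of_measure_periodicPts_eq_zero hinv haper
  obtain ⟨C, hCA, hC, hCret, hCsweep⟩ := exists_sweeping_subset R hA 1
  have hAC : μ (A \ orbitSaturation R C) = 0 := measure_mono_null (by grind) haper
  obtain ⟨δ, hδ, hsat⟩ := exists_forall_measure_pos_and_orbitSaturation_sdiff_lt hinv hpos.ne' hC
    hAC (ENNReal.ofReal_pos.2 hε).ne'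
  have hδ2 : δ / 2 ≠ 0 := (ENNReal.half_pos hδ).ne'
  obtain ⟨Z, hZ, hZμ⟩ := exists_isExceptionalSet (d := d) hinv haper hδ2
  obtain ⟨K, hKB, hK, hKsupp, hKret, hKμ⟩ := hZ.exists_isClosed_subset_support hinv
    (hC.diff hZ.measurableSet) disjoint_sdiff_left hδ2
  have hKC : K ⊆ C := hKB.trans sdiff_subset
  have hKZ : Disjoint K Z := disjoint_sdiff_left.mono_left hKB
  have hloss : μ (C \ K) < δ := calc
    μ (C \ K) ≤ μ Z + μ ((C \ Z) \ K) := (measure_mono (by grind)).trans (measure_union_le _ _)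
    _ < δ / 2 + δ / 2 := ENNReal.add_lt_add hZμ hKμ
    _ = δ := ENNReal.add_halves δ
  obtain ⟨hKpos, hKsat⟩ := hsat K hloss
  exact ⟨K, hZ.isCantorSet hK hKZ hKsupp (nonempty_of_measure_ne_zero hKpos.ne'), hKC.trans hCA,
    hKret.isDynamicallyCoherent hKZ fun x hx =>
      hZ.hasLongRunsIn_of_notMem x (hKZ.notMem_of_mem_left hx),
    (hCret.mono hKC).disjoint_image, hZ.isTamelyEmbedded hK hKZ,
    isDynamicallyMeagre_of_ae_mem_closure hKsupp hKZ hZ.ae_mem_closure,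
    abs_measureReal_sub_lt_of_subset (orbitSaturation_mono (hKC.trans hCA))
      (measurableSet_orbitSaturation hK.measurableSet) hKsat, hKpos⟩

theorem propositionp (d : ℕ) {M : Type*} [TopologicalSpace M] [T2Space M] [CompactSpace M]
    [ChartedSpace (EuclideanSpace ℝ (Fin d)) M] [MeasurableSpace M] [BorelSpace M]
    (R : M ≃ₜ M) (μ : MeasureTheory.Measure M) [MeasureTheory.IsProbabilityMeasure μ]
    (hinv : MeasureTheory.MeasurePreserving R μ μ)
    (haper : μ (Function.periodicPts R) = 0)
    (A : Set M) (hA : MeasurableSet A) (hpos : 0 < μ A) :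
    ∀ ε : ℝ, 0 < ε → ∃ K : Set M, IsCantorSet K ∧ K ⊆ A ∧ IsDynamicallyCoherent R K ∧
      Disjoint K (R '' K) ∧ IsTamelyEmbedded d K ∧ IsDynamicallyMeagre R K ∧
      |μ.real (orbitSaturation R A) - μ.real (orbitSaturation R K)| < ε ∧ 0 < μ K :=
  propositionp_general d R μ hinv haper A hA hpos
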